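/- Let $K$ be a number field with ring of integers $\mathcal O_K$, let $\Sigma_K$ be the set of all (finite and infinite) places of $K$, let $\mathbb A_K=\prod'_{v\in\Sigma_K}(K_v,\mathcal O_{K,v})$ be the adele ring, $\mathbb A_K^*$ the idele group (with its restricted product topology), and $C_K=\mathbb A_K^*/K^*$ the idele class group. The quotient topology on $C_K$ is called the idelic topology. Let $\|\cdot\|\colon C_K\to\mathbb R_{>0}$ be the norm induced by $\|a\|=\prod_{v\in\Sigma_K}|a_v|_v$ for $a\in\mathbb A_K^*$, with normalised absolute values $|\cdot|_v$. For $a\in\mathbb A_K$ put $\mathcal Z(a)=\{v\in\Sigma_K : a_v=0\}$, and define \[ \Xi\colon \mathbb A_K\to 2^{\Sigma_K}\sqcup C_K,\qquad \Xi(a)=\begin{cases}\mathcal Z(a) & \text{if } a\in\mathbb A_K\setminus\mathbb A_K^*,\\ aK^* & \text{if } a\in\mathbb A_K^*.\end{cases} \] The quasi-orbit topology $\mathrm{qo}$ on $2^{\Sigma_K}\sqcup C_K$ is the quotient topology along $\Xi$, that is, $U$ is open if and only if $\Xi^{-1}(U)$ is open in $\mathbb A_K$ for the adelic topology. The power-cofinite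 topology $\mathrm{pc}$ on $2^{\Sigma_K}$ is the topology with basic open sets $\{T\subseteq\Sigma_K : T\cap F=\emptyset\}$, $F\subseteq\Sigma_K$ finite. Write $\overline{X}^{\tau}$ for the closure of $X$ in the topology $\tau$, and $\mathrm{id}$ for the idelic topology on $C_K$. (1) For every subset $B\subseteq C_K$, \[ \overline{B}^{\mathrm{qo}}=\begin{cases}\overline{B}^{\mathrm{id}} & \text{if } 0\notin\overline{\{\|b\| : b\in B\}},\\ 2^{\Sigma_K}\sqcup C_K & \text{if } 0\in\overline{\{\|b\| : b\in B\}},\end{cases} \] where the closure of the set of norms is taken in $\mathbb R$. (2) For every subset $A\subseteq 2^{\Sigma_K}$, \[ \overline{A}^{\mathrm{qo}}=\begin{cases}\overline{A}^{\mathrm{pc}} & \text{if } \overline{A}^{\mathrm{pc}}\subsetneq 2^{\Sigma_K},\\ 2^{\Sigma_K}\sqcup C_K & \text{if } \overline{A}^{\mathrm{pc}}=2^{\Sigma_K}.\end{cases} \] In particular, the topology induced on $2^{\Sigma_K}$ as a subspace of $(2^{\Sigma_K}\sqcup C_K,\mathrm{qo})$ is the power-cofinite topology. -/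

import Mathlib

open scoped Topology

namespace AdelicQuasiOrbit

open NumberField IsDedekindDomain

noncomputable section

/-- The places of a number field `K`: the infinite places, together with the nonzero prime ideals
of the ring of integers (which index the finite places). -/
abbrev Place (K : Type*) [Field K] : Type _ :=
  InfinitePlace K ⊕ HeightOneSpectrum (𝓞 K)

/-- The set `2 ^ X` of all subsets of `X` carries the power-cofinite topology, generated by (in
fact with basis) the sets `{T | T ∩ F = ∅}` for finite `F ⊆ X`. -/
@[reducible] def powerCofinite (X : Type*) : TopologicalSpace (Set X) :=
  TopologicalSpace.generateFrom {U | ∃ F : Finset X, U = {T : Set X | T ∩ (F : Set X) = ∅}}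

theorem isTopologicalBasis_powerCofinite (X : Type*) :
    @TopologicalSpace.IsTopologicalBasis (Set X) (powerCofinite X)
      {U | ∃ F : Finset X, U = {T : Set X | T ∩ (F : Set X) = ∅}} := by
  classical
  let _ := powerCofinite X
  refine ⟨?_, ?_, rfl⟩
  · rintro _ ⟨F, rfl⟩ _ ⟨G, rfl⟩ T ⟨hF, hG⟩
    refine ⟨_, ⟨F ∪ G, rfl⟩, ?_, ?_⟩
    · change T ∩ (F ∪ G : Finset X) = ∅
      rw [Finset.coe_union, Set.inter_union_distrib_left]
      exact Set.union_empty_iff.2 ⟨hF, hG⟩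
    · intro S hS
      change S ∩ (F ∪ G : Finset X) = ∅ at hS
      rw [Finset.coe_union, Set.inter_union_distrib_left] at hS
      exact Set.union_empty_iff.1 hS
  · exact Set.eq_univ_of_univ_subset (Set.subset_sUnion_of_mem ⟨∅, by simp⟩)

variable (K : Type*) [Field K] [NumberField K]

/-- The adele ring of `K`, with Mathlib's (restricted product) topology. -/
abbrev Adele : Type _ := AdeleRing (𝓞 K) K

/-- The idele group of `K`, with the topology of a unit group, i.e. the topology induced by
`a ↦ (a, a⁻¹)`; it is the restricted product topology of the `K_v ˣ` with respect to `O_v ˣ`. -/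
abbrev Idele : Type _ := (Adele K)ˣ

/-- The subgroup `K ˣ` of principal ideles. -/
abbrev principalIdeles : Subgroup (Idele K) :=
  (Units.map (algebraMap K (Adele K)).toMonoidHom).range

/-- The idele class group; its quotient topology is the idelic topology. -/
abbrev IdeleClass : Type _ := Idele K ⧸ principalIdeles K

variable {K}

/-- The set of places at which the adele `a` vanishes. -/
def zeroSet (a : Adele K) : Set (Place K) :=
  {v | Sum.elim (fun w ↦ a.1 w = 0) (fun p ↦ a.2 p = 0) v}

variable (K)

open scoped Classical in
/-- The quasi-orbit map: an adele that is not an idele goes to its zero set, and an idele goes to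
its class. -/
def quasiOrbitMap (a : Adele K) : Set (Place K) ⊕ IdeleClass K :=
  if h : IsUnit a then Sum.inr (QuotientGroup.mk h.unit) else Sum.inl (zeroSet a)

/-- The quasi-orbit topology: the quotient topology along the quasi-orbit map from the adeles with
their adelic topology. -/
@[reducible] def quasiOrbitTopology : TopologicalSpace (Set (Place K) ⊕ IdeleClass K) :=
  TopologicalSpace.coinduced (quasiOrbitMap K) inferInstance

variable {K}

theorem finite_norm_ne_one (a : Idele K) :
    (Function.mulSupport fun p : HeightOneSpectrum (𝓞 K) ↦ ‖(a : Adele K).2 p‖).Finite := by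
  have hu : IsUnit (a : Adele K).2 := a.isUnit.map (RingHom.snd (InfiniteAdeleRing K)
    (FiniteAdeleRing (𝓞 K) K))
  have h := (FiniteAdeleRing.isUnit_iff.1 hu).2
  refine Set.Finite.subset h fun p hp hv ↦ hp ?_
  change ‖(a : Adele K).2 p‖ = 1
  have hv' : Valued.v ((a : Adele K).2 p) = 1 := hv
  rw [FinitePlace.norm_def, hv', map_one]
  rfl

/-- The idelic norm `‖a‖ = ∏ v, |a|_v` with normalised absolute values: the usual absolute value
at real places, its square at complex places, and the one with `|π| = 1 / N(p)` for a uniformiser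
`π` at a prime `p`. All but finitely many factors are `1`. -/
def ideleNorm : Idele K →* ℝ where
  toFun a := (∏ w : InfinitePlace K, ‖(a : Adele K).1 w‖ ^ w.mult) *
    ∏ᶠ p : HeightOneSpectrum (𝓞 K), ‖(a : Adele K).2 p‖
  map_one' := by
    have h1 : ∀ w : InfinitePlace K, ‖((1 : Idele K) : Adele K).1 w‖ = 1 := fun w ↦ norm_one
    have h2 : ∀ p : HeightOneSpectrum (𝓞 K), ‖((1 : Idele K) : Adele K).2 p‖ = 1 :=
      fun p ↦ norm_one
    simp only [h1, h2, one_pow, Finset.prod_const_one, finprod_one, mul_one]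
  map_mul' a b := by
    have h1 : ∀ w : InfinitePlace K, ‖((a * b : Idele K) : Adele K).1 w‖ =
      ‖(a : Adele K).1 w‖ * ‖(b : Adele K).1 w‖ := fun w ↦ norm_mul _ _
    have h2 : ∀ p : HeightOneSpectrum (𝓞 K), ‖((a * b : Idele K) : Adele K).2 p‖ =
      ‖(a : Adele K).2 p‖ * ‖(b : Adele K).2 p‖ := fun p ↦ norm_mul _ _
    simp only [h1, h2, mul_pow, Finset.prod_mul_distrib]
    rw [finprod_mul_distrib (finite_norm_ne_one a) (finite_norm_ne_one b)]
    ring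

/-- The product formula: principal ideles have norm one. -/
theorem principalIdeles_le_ker : principalIdeles K ≤ (ideleNorm (K := K)).ker := by
  rintro _ ⟨x, rfl⟩
  have h := prod_abs_eq_one (K := K) x.ne_zero
  rw [← finprod_comp_equiv FinitePlace.equivHeightOneSpectrum.symm] at h
  refine Eq.trans ?_ h
  change (∏ w : InfinitePlace K, ‖((x : K) : w.Completion)‖ ^ w.mult) *
    ∏ᶠ p : HeightOneSpectrum (𝓞 K), ‖FinitePlace.embedding p (x : K)‖ = _
  congr 1
  refine Finset.prod_congr rfl fun w _ ↦ ?_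
  congr 1
  exact InfinitePlace.Completion.norm_coe w _

variable (K) in
/-- The norm on the idele class group induced by the idelic norm. -/
def ideleClassNorm : IdeleClass K →* ℝ :=
  QuotientGroup.lift (principalIdeles K) ideleNorm principalIdeles_le_ker

end

end AdelicQuasiOrbit

open AdelicQuasiOrbit

open scoped Topology

namespace AdelicQuasiOrbit

open NumberField IsDedekindDomain Filter

/-! ### Absolute values at a single place. -/

section Local

variable {K : Type*} [Field K] [NumberField K]

/-! A set is quasi-orbit closed iff its preimage under Ξ is closed, and the quasi-orbit closure of X
contains Ξ of the adelic closure of Ξ⁻¹(X). Everything thus reduces to closures in the adeles, where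
neighbourhoods contain boxes: close at the infinite places and at finitely many primes, integrally
close at the others (`exists_box_of_mem_nhds`).

Zero sets: a ↦ Z(a) is continuous into the power-cofinite topology. Conversely, zero coordinates can
be perturbed, and coordinates outside a finite set can be replaced by ones of absolute value < 1, so
an adele whose zero set is adherent to A is a limit of non-ideles with zero set in A
(`mem_closure_of_zeroSet_mem_closure`). The dichotomy comes from the ideles: their zero set is ∅,
which is adherent only to dense A.

Classes with norms bounded below: norms of ideles tend to 0 near a non-idele
(`eventually_ideleNorm_lt`), so adelic limits remain ideles. Near a given idele, the lower bound
also forces coordinates to be units at all primes of large norm, so inversion is adelically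
continuous (`tendsto_inv_of_le_ideleNorm`). Hence adelic and idelic closures agree.

Classes with norms accumulating at 0: by Minkowski, an idele of small norm can be moved inside its
class to some b in a small box (`exists_principal_mul_mem_box`). Since 𝔸 = K + bounded box
(`exists_forall_exists_box`), b⁻¹a = y + r with y in K and r bounded, so a = by + br with br small.
For y ≠ 0 the idele by has the class of b and lies near a, so the class preimage is dense
(`dense_coe_preimage_mk`). -/

theorem norm_le_one_iff_mem (p : HeightOneSpectrum (𝓞 K)) (x : p.adicCompletion K) :
    ‖x‖ ≤ 1 ↔ x ∈ p.adicCompletionIntegers K :=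
  Valued.toNormedField.norm_le_one_iff

theorem norm_eq_one_iff_valued (p : HeightOneSpectrum (𝓞 K)) (x : p.adicCompletion K) :
    ‖x‖ = 1 ↔ Valued.v x = 1 := by
  rw [le_antisymm_iff, Valued.toNormedField.norm_le_one_iff, Valued.toNormedField.one_le_norm_iff,
    le_antisymm_iff]

theorem exists_norm_lt_of_norm_lt_one {F : Type*} [NormedField F] {x : F} (h0 : x ≠ 0)
    (h1 : ‖x‖ < 1) {ε : ℝ} (hε : 0 < ε) : ∃ y : F, y ≠ 0 ∧ ‖y‖ < ε := by
  obtain ⟨n, hn⟩ := exists_pow_lt_of_lt_one hε h1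
  exact ⟨x ^ n, pow_ne_zero n h0, by rwa [norm_pow]⟩

theorem exists_ne_zero_norm_lt_one (p : HeightOneSpectrum (𝓞 K)) :
    ∃ x : p.adicCompletion K, x ≠ 0 ∧ ‖x‖ < 1 := by
  obtain ⟨r, hr, hr0⟩ := Submodule.exists_mem_ne_zero_of_ne_bot p.ne_bot
  refine ⟨FinitePlace.embedding p (algebraMap _ K r), ?_,
    (FinitePlace.norm_lt_one_iff_mem K p r).2 hr⟩
  simpa using hr0

theorem exists_norm_lt_finite (p : HeightOneSpectrum (𝓞 K)) {ε : ℝ} (hε : 0 < ε) :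
    ∃ x : p.adicCompletion K, x ≠ 0 ∧ ‖x‖ < ε := by
  obtain ⟨x, h0, h1⟩ := exists_ne_zero_norm_lt_one p
  exact exists_norm_lt_of_norm_lt_one h0 h1 hε

theorem exists_norm_lt_infinite (w : InfinitePlace K) {ε : ℝ} (hε : 0 < ε) :
    ∃ x : w.Completion, x ≠ 0 ∧ ‖x‖ < ε := by
  refine exists_norm_lt_of_norm_lt_one (x := ((2 : K)⁻¹ : w.Completion)) ?_ ?_ hε
  · exact inv_ne_zero fun h ↦ two_ne_zero
      ((algebraMap K w.Completion).injective (h.trans (map_zero (algebraMap K w.Completion)).symm))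
  · rw [norm_inv, show ‖((2 : K) : w.Completion)‖ = w 2 from
      InfinitePlace.Completion.norm_coe w _, ← InfinitePlace.norm_embedding_eq, map_ofNat]
    norm_num

theorem exists_norm_eq_zpow (p : HeightOneSpectrum (𝓞 K)) {x : p.adicCompletion K} (hx : x ≠ 0) :
    ∃ n : ℤ, ‖x‖ = (Ideal.absNorm p.asIdeal : ℝ) ^ n := by
  have hv : Valued.v x ≠ 0 := (Valuation.ne_zero_iff _).2 hx
  refine ⟨(WithZero.unzero hv).toAdd, ?_⟩
  rw [FinitePlace.norm_def, WithZeroMulInt.toNNReal_neg_apply _ hv]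
  push_cast
  rfl

theorem one_lt_absNorm_real (p : HeightOneSpectrum (𝓞 K)) : (1 : ℝ) < Ideal.absNorm p.asIdeal := by
  exact_mod_cast HeightOneSpectrum.one_lt_absNorm p

/-- The value group is discrete: norms of nonzero elements are integral powers of N(p). -/
theorem norm_mul_absNorm_le_one (p : HeightOneSpectrum (𝓞 K)) {x : p.adicCompletion K}
    (h : ‖x‖ < 1) : ‖x‖ * (Ideal.absNorm p.asIdeal : ℝ) ≤ 1 := by
  rcases eq_or_ne x 0 with rfl | hx
  · simp
  obtain ⟨n, hn⟩ := exists_norm_eq_zpow p hx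
  have hN := one_lt_absNorm_real p
  rw [hn] at h ⊢
  rw [← zpow_add_one₀ (by positivity)]
  exact zpow_le_one_of_nonpos₀ hN.le (by
    have := (zpow_lt_one_iff_right₀ hN).1 h
    lia)

theorem norm_sub_le_max (p : HeightOneSpectrum (𝓞 K)) (x y : p.adicCompletion K) :
    ‖x - y‖ ≤ max ‖x‖ ‖y‖ := by
  rw [sub_eq_add_neg, ← norm_neg y]
  exact IsUltrametricDist.norm_add_le_max x (-y)

end Local

/-- Every rational prime lies in some maximal ideal, and distinct rational primes, being coprime,
cannot share one. This makes the cofinite filter on primes nontrivial, so a condition at almost all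
primes holds at some prime. -/
instance infinite_heightOneSpectrum (K : Type*) [Field K] [NumberField K] :
    Infinite (HeightOneSpectrum (𝓞 K)) := by
  have h : ∀ l : Nat.Primes, ∃ p : HeightOneSpectrum (𝓞 K), ((l : ℕ) : 𝓞 K) ∈ p.asIdeal := by
    intro l
    have hl : ¬ IsUnit ((l : ℕ) : 𝓞 K) := by
      intro hu
      have hu' : IsUnit (algebraMap ℤ (𝓞 K) (l : ℕ)) := by simpa using hu
      have hloc : IsLocalHom (algebraMap ℤ (𝓞 K)) :=
        (algebraMap_isIntegral_iff.2 inferInstance).isLocalHom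
          (RingHom.injective_int (algebraMap ℤ (𝓞 K)))
      have := Int.isUnit_iff_natAbs_eq.1 (hloc.map_nonunit _ hu')
      exact l.2.one_lt.ne' (by simpa using this)
    obtain ⟨M, hM, hlM⟩ := exists_max_ideal_of_mem_nonunits hl
    refine ⟨⟨M, hM.isPrime, ?_⟩, hlM⟩
    rintro rfl
    exact l.2.ne_zero (by simpa using hlM)
  choose f hf using h
  refine Infinite.of_injective f fun l m hlm ↦ ?_
  by_contra hne
  have hco : Nat.Coprime l m := (Nat.coprime_primes l.2 m.2).2 fun h ↦ hne (Subtype.ext h)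
  have h1 := hf l
  have h2 := hf m
  rw [← hlm] at h2
  have hc : IsCoprime ((l : ℕ) : 𝓞 K) ((m : ℕ) : 𝓞 K) := by
    simpa using (Nat.isCoprime_iff_coprime.2 hco).map (Int.castRingHom (𝓞 K))
  obtain ⟨a, b, hab⟩ := hc
  exact (f l).isPrime.ne_top ((Ideal.eq_top_iff_one _).2
    (hab ▸ Ideal.add_mem _ (Ideal.mul_mem_left _ a h1) (Ideal.mul_mem_left _ b h2)))

/-! ### Units and box neighbourhoods in the adele ring. -/

section Topology

variable {K : Type*} [Field K] [NumberField K]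

theorem isUnit_adele_iff (a : Adele K) : IsUnit a ↔ (∀ w, a.1 w ≠ 0) ∧ (∀ p, a.2 p ≠ 0) ∧
    ∀ᶠ p in cofinite, ‖a.2 p‖ = 1 := by
  have h : IsUnit a ↔ IsUnit a.1 ∧ IsUnit a.2 := Prod.isUnit_iff
  have h1 : IsUnit a.1 ↔ ∀ w, a.1 w ≠ 0 := by
    refine (Pi.isUnit_iff (M := fun w : InfinitePlace K ↦ w.Completion)).trans ?_
    simp only [isUnit_iff_ne_zero]
  rw [h, h1, FiniteAdeleRing.isUnit_iff]
  simp only [norm_eq_one_iff_valued]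

theorem continuous_infinite_coord (w : InfinitePlace K) : Continuous fun a : Adele K ↦ a.1 w :=
  (continuous_apply (A := fun w : InfinitePlace K ↦ w.Completion) w).comp
    (continuous_fst (X := InfiniteAdeleRing K) (Y := FiniteAdeleRing (𝓞 K) K))

theorem continuous_finite_coord (p : HeightOneSpectrum (𝓞 K)) :
    Continuous fun a : Adele K ↦ a.2 p :=
  (RestrictedProduct.continuous_eval (R := fun p : HeightOneSpectrum (𝓞 K) ↦ p.adicCompletion K)
    (A := fun p ↦ (p.adicCompletionIntegers K : Set (p.adicCompletion K))) (𝓕 := cofinite) p).comp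
    (continuous_snd (X := InfiniteAdeleRing K) (Y := FiniteAdeleRing (𝓞 K) K))

/-- The adele with given coordinates. -/
def Adele.mk (x : ∀ w : InfinitePlace K, w.Completion)
    (y : ∀ p : HeightOneSpectrum (𝓞 K), p.adicCompletion K)
    (hy : ∀ᶠ p in cofinite, ‖y p‖ ≤ 1) : Adele K :=
  (x, ⟨y, hy.mono fun p hp ↦ (norm_le_one_iff_mem p _).1 hp⟩)

theorem eventually_norm_le_one (a : Adele K) : ∀ᶠ p in cofinite, ‖a.2 p‖ ≤ 1 :=
  a.2.2.mono fun p hp ↦ (norm_le_one_iff_mem p _).2 hp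

theorem isOpen_adicCompletionIntegers : ∀ p : HeightOneSpectrum (𝓞 K),
    IsOpen (p.adicCompletionIntegers K : Set (p.adicCompletion K)) :=
  fun _ ↦ Valued.isOpen_valuationSubring _

theorem setOf_forall_norm_sub_le_mem_nhds (a : Adele K) :
    {b : Adele K | ∀ p, ‖b.2 p - a.2 p‖ ≤ 1} ∈ 𝓝 a := by
  have h0 : {b : FiniteAdeleRing (𝓞 K) K | ∀ p, ‖b p‖ ≤ 1} ∈ 𝓝 0 := by
    have := (RestrictedProduct.isOpen_forall_mem (isOpen_adicCompletionIntegers (K := K))).mem_nhds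
      (x := (0 : FiniteAdeleRing (𝓞 K) K)) fun p ↦ ZeroMemClass.zero_mem _
    filter_upwards [this] with b hb p using (norm_le_one_iff_mem p _).2 (hb p)
  have hc : Tendsto (fun b : Adele K ↦ b.2 - a.2) (𝓝 a) (𝓝 0) := by
    have := ((continuous_snd (X := InfiniteAdeleRing K) (Y := FiniteAdeleRing (𝓞 K) K)).tendsto
      a).sub_const a.2
    rwa [sub_self] at this
  exact hc h0

/-- Near 0 the restricted product looks like the full product of the open integer rings, whose
neighbourhoods constrain only finitely many coordinates. -/
theorem exists_box_of_mem_nhds_zero {U : Set (FiniteAdeleRing (𝓞 K) K)}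
    (hU : U ∈ 𝓝 (0 : FiniteAdeleRing (𝓞 K) K)) :
    ∃ S : Finset (HeightOneSpectrum (𝓞 K)), ∃ ε > 0, ∀ b : FiniteAdeleRing (𝓞 K) K,
      (∀ p, ‖b p‖ ≤ 1) → (∀ p ∈ S, ‖b p‖ < ε) → b ∈ U := by
  have h := RestrictedProduct.nhds_zero_eq_map_structureMap
    (fun p : HeightOneSpectrum (𝓞 K) ↦ p.adicCompletion K) (isOpen_adicCompletionIntegers (K := K))
  have hU' : RestrictedProduct.structureMap (fun p : HeightOneSpectrum (𝓞 K) ↦ p.adicCompletion K)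
    (fun p ↦ (p.adicCompletionIntegers K : Set (p.adicCompletion K))) cofinite ⁻¹' U ∈ 𝓝 0 :=
    mem_map.1 (h.ge hU)
  rw [nhds_pi, Filter.mem_pi'] at hU'
  obtain ⟨S, t, ht, htU⟩ := hU'
  have ht' : ∀ p, ∃ ε > 0, ∀ x : p.adicCompletionIntegers K, ‖(x : p.adicCompletion K)‖ < ε → x ∈ t p := by
    intro p
    obtain ⟨u, hu, hut⟩ := mem_nhds_subtype _ _ _ |>.1 (ht p)
    obtain ⟨ε, hε, hb⟩ := Metric.mem_nhds_iff.1 hu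
    exact ⟨ε, hε, fun x hx ↦ hut (hb (by simpa using hx))⟩
  choose ε hε hεt using ht'
  obtain ⟨δ, hδ, hδε⟩ : ∃ δ > 0, ∀ p ∈ S, δ ≤ ε p := by
    rcases S.eq_empty_or_nonempty with rfl | hS
    · exact ⟨1, one_pos, by simp⟩
    · exact ⟨S.inf' hS ε, (Finset.lt_inf'_iff hS).2 fun p _ ↦ hε p, fun p hp ↦ Finset.inf'_le _ hp⟩
  refine ⟨S, δ, hδ, fun b hb hbS ↦ ?_⟩
  exact htU (a := fun p ↦ ⟨b p, (norm_le_one_iff_mem p _).1 (hb p)⟩)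
    fun p hp ↦ hεt p _ ((hbS p hp).trans_le (hδε p hp))

theorem exists_box_of_mem_nhds {a : Adele K} {U : Set (Adele K)} (hU : U ∈ 𝓝 a) :
    ∃ S : Finset (HeightOneSpectrum (𝓞 K)), ∃ ε > 0, ∀ b : Adele K,
      (∀ w, ‖b.1 w - a.1 w‖ < ε) → (∀ p, ‖b.2 p - a.2 p‖ ≤ 1) →
      (∀ p ∈ S, ‖b.2 p - a.2 p‖ < ε) → b ∈ U := by
  have hc : Tendsto (fun b : InfiniteAdeleRing K × FiniteAdeleRing (𝓞 K) K ↦ (show Adele K from b) + a)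
      (𝓝 0 ×ˢ 𝓝 0) (𝓝 a) := by
    have := (tendsto_id (x := 𝓝 (0 : Adele K))).add_const a
    rw [zero_add] at this
    rw [← nhds_prod_eq]
    exact this
  obtain ⟨V, hV, W, hW, hVW⟩ := Filter.mem_prod_iff.1 (hc hU)
  obtain ⟨S, δ, hδ, hS⟩ := exists_box_of_mem_nhds_zero hW
  have hV' : ∃ ε > 0, ∀ x : InfiniteAdeleRing K, (∀ w, ‖x w‖ < ε) → x ∈ V := by
    obtain ⟨ε, hε, h⟩ := Metric.mem_nhds_iff (α := ∀ w : InfinitePlace K, w.Completion) (x := 0).1 hV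
    refine ⟨ε, hε, fun x hx ↦ h ?_⟩
    exact mem_ball_zero_iff.2 ((pi_norm_lt_iff hε).2 hx)
  obtain ⟨ε, hε, hεV⟩ := hV'
  refine ⟨S, min ε δ, lt_min hε hδ, fun b h1 h2 h3 ↦ ?_⟩
  have : ((b.1 - a.1, b.2 - a.2) : InfiniteAdeleRing K × FiniteAdeleRing (𝓞 K) K) ∈ V ×ˢ W :=
    ⟨hεV _ fun w ↦ (h1 w).trans_le (min_le_left _ _),
      hS _ h2 fun p hp ↦ (h3 p hp).trans_le (min_le_right _ _)⟩
  have h := hVW this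
  have e : ((show Adele K from (b.1 - a.1, b.2 - a.2)) + a) = b :=
    Prod.ext (sub_add_cancel b.1 a.1) (sub_add_cancel b.2 a.2)
  simpa only [Set.mem_preimage, e] using h

end Topology

/-! ### Closures in the power-cofinite topology. -/

section PowerCofinite

theorem mem_closure_powerCofinite {X : Type*} {A : Set (Set X)} {T : Set X} :
    T ∈ closure[powerCofinite X] A ↔
      ∀ F : Finset X, T ∩ (F : Set X) = ∅ → ∃ S ∈ A, S ∩ (F : Set X) = ∅ := by
  let _ := powerCofinite X
  rw [(isTopologicalBasis_powerCofinite X).mem_closure_iff]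
  constructor
  · intro h F hF
    obtain ⟨S, hS, hSA⟩ := h _ ⟨F, rfl⟩ hF
    exact ⟨S, hSA, hS⟩
  · rintro h _ ⟨F, rfl⟩ hF
    obtain ⟨S, hSA, hS⟩ := h F hF
    exact ⟨S, hS, hSA⟩

/-- The point ∅ lies in every basic open set, so it is the hardest point to adhere to A. -/
theorem closure_powerCofinite_eq_univ_iff {X : Type*} {A : Set (Set X)} :
    closure[powerCofinite X] A = Set.univ ↔ ∅ ∈ closure[powerCofinite X] A := by
  refine ⟨fun h ↦ h ▸ Set.mem_univ _, fun h ↦ Set.eq_univ_of_forall fun T ↦ ?_⟩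
  rw [mem_closure_powerCofinite] at h ⊢
  exact fun F _ ↦ h F (Set.empty_inter _)

end PowerCofinite

variable {K : Type*} [Field K] [NumberField K]

/-! ### Zero sets of adeles and approximation by non-ideles. -/

theorem inl_mem_zeroSet {a : Adele K} {w : InfinitePlace K} :
    (Sum.inl w : Place K) ∈ zeroSet a ↔ a.1 w = 0 := Iff.rfl

theorem inr_mem_zeroSet {a : Adele K} {p : HeightOneSpectrum (𝓞 K)} :
    (Sum.inr p : Place K) ∈ zeroSet a ↔ a.2 p = 0 := Iff.rfl

theorem zeroSet_eq_empty_of_isUnit {a : Adele K} (ha : IsUnit a) : zeroSet a = ∅ := by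
  rw [isUnit_adele_iff] at ha
  refine Set.eq_empty_of_forall_notMem ?_
  rintro (w | p) h
  · exact ha.1 w h
  · exact ha.2.1 p h

theorem continuous_zeroSet : Continuous[_, powerCofinite (Place K)] (zeroSet (K := K)) := by
  rw [continuous_generateFrom_iff]
  rintro _ ⟨F, rfl⟩
  have : zeroSet (K := K) ⁻¹' {T | T ∩ (F : Set (Place K)) = ∅} =
      ⋂ v ∈ F, {a | v ∉ zeroSet a} := by
    ext a
    simp only [Set.mem_preimage, Set.mem_ofPred_eq, Set.mem_iInter,
      ← Set.disjoint_iff_inter_eq_empty, Set.disjoint_right, Finset.mem_coe]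
  rw [this]
  refine isOpen_biInter_finset ?_
  rintro (w | p) -
  · exact isOpen_ne.preimage (continuous_infinite_coord w)
  · exact isOpen_ne.preimage (continuous_finite_coord p)

theorem not_isUnit_of_eventually_ne_one {a : Adele K} (h : ∀ᶠ p in cofinite, ‖a.2 p‖ ≠ 1) :
    ¬ IsUnit a := fun ha ↦ by
  obtain ⟨p, hp, hp'⟩ := (h.and ((isUnit_adele_iff a).1 ha).2.2).exists
  exact hp hp'

/-- Taking absolute value < 1 at every prime prevents invertibility even when T is empty. -/
theorem exists_not_isUnit_zeroSet_eq (T : Set (Place K)) :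
    ∃ a : Adele K, ¬ IsUnit a ∧ zeroSet a = T := by
  classical
  choose ϖ h0 h1 using exists_ne_zero_norm_lt_one (K := K)
  have hn : ∀ p, ‖if Sum.inr p ∈ T then 0 else ϖ p‖ < 1 := fun p ↦ by
    split_ifs
    · simp
    · exact h1 p
  refine ⟨Adele.mk (fun w ↦ if Sum.inl w ∈ T then 0 else 1)
    (fun p ↦ if Sum.inr p ∈ T then 0 else ϖ p) (Eventually.of_forall fun p ↦ (hn p).le),
    not_isUnit_of_eventually_ne_one (Eventually.of_forall fun p ↦ (hn p).ne), ?_⟩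
  ext (w | p)
  · rw [inl_mem_zeroSet]
    change (if Sum.inl w ∈ T then (0 : w.Completion) else 1) = 0 ↔ _
    simp
  · rw [inr_mem_zeroSet]
    change (if Sum.inr p ∈ T then 0 else ϖ p) = 0 ↔ _
    simp [h0]

theorem exists_norm_sub_lt_eq_zero_iff {F : Type*} [NormedField F]
    (hF : ∀ ε > 0, ∃ x : F, x ≠ 0 ∧ ‖x‖ < ε) (b : F) {P : Prop} (hP : P → b = 0) {ε : ℝ}
    (hε : 0 < ε) : ∃ c : F, (c = 0 ↔ P) ∧ ‖c - b‖ < ε := by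
  by_cases h : P
  · exact ⟨0, by simpa using h, by simpa [hP h] using hε⟩
  by_cases hb : b = 0
  · obtain ⟨x, hx, hxε⟩ := hF ε hε
    exact ⟨x, by simpa [hx] using h, by simpa [hb] using hxε⟩
  · exact ⟨b, by simpa [hb] using h, by simpa using hε⟩

/-- An adele whose zero set is adherent to `A` is a limit of non-invertible adeles with zero set
in `A`. -/
theorem mem_closure_of_zeroSet_mem_closure {A : Set (Set (Place K))} {b : Adele K}
    (h : zeroSet b ∈ closure[powerCofinite (Place K)] A) :
    b ∈ closure {c | ¬ IsUnit c ∧ zeroSet c ∈ A} := by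
  classical
  rw [mem_closure_powerCofinite] at h
  rw [mem_closure_iff_nhds]
  intro U hU
  obtain ⟨S, ε, hε, hbox⟩ := exists_box_of_mem_nhds hU
  have hbad : {p | ¬ ‖b.2 p‖ ≤ 1}.Finite := eventually_norm_le_one b
  -- Outside S' the adele b is integral and the box only demands an integral difference.
  let S' : Finset (HeightOneSpectrum (𝓞 K)) := S ∪ hbad.toFinset
  -- Test adherence on the finitely many controlled places where b does not vanish: there Z imposes
  -- no zero, so b can be approximated with zero set exactly Z.
  obtain ⟨Z, hZA, hZ⟩ := h
    ((Finset.univ.disjSum S').filter fun v ↦ v ∉ zeroSet b) (by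
      ext v
      simp +contextual)
  have hZ' : ∀ v ∈ Finset.univ.disjSum S', v ∈ Z → v ∈ zeroSet b := fun v hv hvZ ↦ by
    by_contra hvb
    exact Set.notMem_empty v (hZ ▸ ⟨hvZ, by simpa using ⟨by simpa using hv, hvb⟩⟩)
  have hinf : ∀ w, ∃ c : w.Completion, (c = 0 ↔ Sum.inl w ∈ Z) ∧ ‖c - b.1 w‖ < ε := fun w ↦
    exists_norm_sub_lt_eq_zero_iff (fun δ hδ ↦ exists_norm_lt_infinite w hδ) _
      (fun hw ↦ hZ' (Sum.inl w) (by simp) hw) hε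
  have hfin : ∀ p, ∃ c : p.adicCompletion K, (c = 0 ↔ Sum.inr p ∈ Z) ∧
      ‖c - b.2 p‖ ≤ 1 ∧ (p ∈ S' → ‖c - b.2 p‖ < ε) ∧ (p ∉ S' → ‖c‖ < 1) := by
    intro p
    by_cases hp : p ∈ S'
    · obtain ⟨c, hc, hc'⟩ := exists_norm_sub_lt_eq_zero_iff
        (fun δ hδ ↦ exists_norm_lt_finite p hδ) (b.2 p)
        (fun hw ↦ hZ' (Sum.inr p) (by simpa using hp) hw) (lt_min hε one_pos)
      exact ⟨c, hc, (hc'.trans_le (min_le_right _ _)).le, fun _ ↦ hc'.trans_le (min_le_left _ _),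
        fun h ↦ absurd hp h⟩
    · have hb : ‖b.2 p‖ ≤ 1 := by
        by_contra hb
        exact hp (Finset.mem_union_right _ (hbad.mem_toFinset.2 hb))
      -- At uncontrolled primes approximate 0 rather than b: absolute value < 1 stays in the box and
      -- makes the resulting adele non-invertible.
      obtain ⟨c, hc, hc'⟩ := exists_norm_sub_lt_eq_zero_iff
        (fun δ hδ ↦ exists_norm_lt_finite p hδ) 0 (fun _ : Sum.inr p ∈ Z ↦ rfl) one_pos
      rw [sub_zero] at hc'
      exact ⟨c, hc, (norm_sub_le_max p c (b.2 p)).trans (max_le hc'.le hb),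
        fun h ↦ absurd h hp, fun _ ↦ hc'⟩
  choose x hx0 hx using hinf
  choose y hy0 hy1 hyε hy using hfin
  have hy' : ∀ᶠ p in cofinite, ‖y p‖ < 1 :=
    S'.finite_toSet.subset fun p (hp : ¬ _) ↦ by
      by_contra hpS
      exact hp (hy p hpS)
  refine ⟨Adele.mk x y (hy'.mono fun p ↦ le_of_lt),
    hbox _ hx hy1 fun p hp ↦ hyε p (Finset.mem_union_left _ hp),
    not_isUnit_of_eventually_ne_one (hy'.mono fun p ↦ ne_of_lt), ?_⟩
  convert hZA
  ext (w | p)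
  · exact hx0 w
  · exact hy0 p

/-! ### The quasi-orbit map and closures of sets of zero sets. -/

theorem quasiOrbitMap_of_not_isUnit {a : Adele K} (h : ¬ IsUnit a) :
    quasiOrbitMap K a = Sum.inl (zeroSet a) := dif_neg h

theorem quasiOrbitMap_coe (a : Idele K) :
    quasiOrbitMap K (a : Adele K) = Sum.inr (QuotientGroup.mk a) := by
  rw [quasiOrbitMap, dif_pos a.isUnit, IsUnit.unit_of_val_units]

theorem quasiOrbitMap_surjective : Function.Surjective (quasiOrbitMap K) := by
  rintro (T | c)
  · obtain ⟨a, ha, rfl⟩ := exists_not_isUnit_zeroSet_eq T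
    exact ⟨a, quasiOrbitMap_of_not_isUnit ha⟩
  · obtain ⟨a, rfl⟩ := QuotientGroup.mk_surjective c
    exact ⟨a, quasiOrbitMap_coe a⟩

theorem isClosed_quasiOrbit_iff {C : Set (Set (Place K) ⊕ IdeleClass K)} :
    IsClosed[quasiOrbitTopology K] C ↔ IsClosed (quasiOrbitMap K ⁻¹' C) :=
  isClosed_coinduced

theorem continuous_quasiOrbitMap : Continuous[_, quasiOrbitTopology K] (quasiOrbitMap K) :=
  continuous_coinduced_rng

/-- The quasi-orbit closure of `X` contains the image of the adelic closure of the preimage. -/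
theorem quasiOrbitMap_mem_closure {X : Set (Set (Place K) ⊕ IdeleClass K)} {a : Adele K}
    (ha : a ∈ closure (quasiOrbitMap K ⁻¹' X)) :
    quasiOrbitMap K a ∈ closure[quasiOrbitTopology K] X := by
  let _ := quasiOrbitTopology K
  exact closure_minimal (Set.preimage_mono subset_closure)
    (isClosed_closure.preimage (continuous_quasiOrbitMap (K := K))) ha

theorem quasiOrbitMap_mem_closure_inl {A : Set (Set (Place K))} {a : Adele K}
    (ha : zeroSet a ∈ closure[powerCofinite (Place K)] A) :
    quasiOrbitMap K a ∈ closure[quasiOrbitTopology K] (Sum.inl '' A) := by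
  refine quasiOrbitMap_mem_closure
    (closure_mono ?_ (mem_closure_of_zeroSet_mem_closure ha))
  rintro c ⟨hc, hcA⟩
  exact ⟨_, hcA, (quasiOrbitMap_of_not_isUnit hc).symm⟩

theorem closure_inl_eq_univ {A : Set (Set (Place K))}
    (hA : closure[powerCofinite (Place K)] A = Set.univ) :
    closure[quasiOrbitTopology K] (Sum.inl '' A) = Set.univ := by
  refine Set.eq_univ_of_forall fun x ↦ ?_
  obtain ⟨a, rfl⟩ := quasiOrbitMap_surjective x
  exact quasiOrbitMap_mem_closure_inl (hA ▸ Set.mem_univ _)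

theorem closure_inl_eq {A : Set (Set (Place K))}
    (hA : closure[powerCofinite (Place K)] A ≠ Set.univ) :
    closure[quasiOrbitTopology K] (Sum.inl '' A) =
      Sum.inl '' closure[powerCofinite (Place K)] A := by
  let _ := quasiOrbitTopology K
  let _ := powerCofinite (Place K)
  refine Set.Subset.antisymm (closure_minimal (Set.image_mono subset_closure) ?_) ?_
  · rw [isClosed_quasiOrbit_iff]
    convert isClosed_closure.preimage (continuous_zeroSet (K := K)) using 1
    swap
    · exact A
    ext a
    by_cases ha : IsUnit a
    · obtain ⟨a, rfl⟩ := ha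
      -- For an idele both sides are false, the right one because ∅ is not adherent to the non-dense
      -- set A.
      simp only [Set.mem_preimage, quasiOrbitMap_coe, zeroSet_eq_empty_of_isUnit a.isUnit]
      simpa using mt closure_powerCofinite_eq_univ_iff.2 hA
    · simp [quasiOrbitMap_of_not_isUnit ha]
  · rintro _ ⟨T, hT, rfl⟩
    obtain ⟨a, ha, rfl⟩ := exists_not_isUnit_zeroSet_eq T
    rw [← quasiOrbitMap_of_not_isUnit ha]
    exact quasiOrbitMap_mem_closure_inl hT

/-- A topology is determined by its closure operator, and the closures above, restricted to zero
sets, are the power-cofinite ones in both cases. -/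
theorem induced_inl_quasiOrbitTopology :
    TopologicalSpace.induced Sum.inl (quasiOrbitTopology K) = powerCofinite (Place K) := by
  have h : ∀ A : Set (Set (Place K)),
      closure[TopologicalSpace.induced Sum.inl (quasiOrbitTopology K)] A =
        closure[powerCofinite (Place K)] A := by
    intro A
    ext T
    rw [@closure_induced _ _ (quasiOrbitTopology K) _ T A]
    by_cases hA : closure[powerCofinite (Place K)] A = Set.univ
    · simp [closure_inl_eq_univ hA, hA]
    · simp [closure_inl_eq hA]
  rw [TopologicalSpace.ext_iff_isClosed]
  intro A
  rw [← @closure_eq_iff_isClosed _ (powerCofinite (Place K)) A, ← h,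
    @closure_eq_iff_isClosed _ (.induced Sum.inl (quasiOrbitTopology K)) A]

/-! ### Idelic norms and closures of classes with norm bounded below. -/

theorem ideleNorm_apply (a : Idele K) :
    ideleNorm a = (∏ w : InfinitePlace K, ‖(a : Adele K).1 w‖ ^ w.mult) *
      ∏ᶠ p : HeightOneSpectrum (𝓞 K), ‖(a : Adele K).2 p‖ := rfl

theorem ideleNorm_nonneg (a : Idele K) : 0 ≤ ideleNorm a := by
  rw [ideleNorm_apply]
  exact mul_nonneg (Finset.prod_nonneg fun _ _ ↦ by positivity)
    (finprod_nonneg fun _ ↦ norm_nonneg _)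

theorem infinite_coord_inv (a : Idele K) (w : InfinitePlace K) :
    ((a⁻¹ : Idele K) : Adele K).1 w = ((a : Adele K).1 w)⁻¹ := by
  refine eq_inv_of_mul_eq_one_left ?_
  have : (((a⁻¹ : Idele K) : Adele K) * (a : Adele K)).1 w = (1 : Adele K).1 w := by
    rw [Units.inv_mul]
  exact this

theorem finite_coord_inv (a : Idele K) (p : HeightOneSpectrum (𝓞 K)) :
    ((a⁻¹ : Idele K) : Adele K).2 p = ((a : Adele K).2 p)⁻¹ := by
  refine eq_inv_of_mul_eq_one_left ?_
  have : (((a⁻¹ : Idele K) : Adele K) * (a : Adele K)).2 p = (1 : Adele K).2 p := by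
    rw [Units.inv_mul]
  exact this

/-- The product of the normalised absolute values over the infinite places and the primes in
`T`. -/
noncomputable def partialNorm (T : Finset (HeightOneSpectrum (𝓞 K))) (a : Adele K) : ℝ :=
  (∏ w : InfinitePlace K, ‖a.1 w‖ ^ w.mult) * ∏ p ∈ T, ‖a.2 p‖

theorem partialNorm_nonneg (T : Finset (HeightOneSpectrum (𝓞 K))) (a : Adele K) :
    0 ≤ partialNorm T a :=
  mul_nonneg (Finset.prod_nonneg fun _ _ ↦ by positivity)
    (Finset.prod_nonneg fun _ _ ↦ norm_nonneg _)

theorem continuous_partialNorm (T : Finset (HeightOneSpectrum (𝓞 K))) :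
    Continuous (partialNorm T) :=
  (continuous_finsetProd _ fun w _ ↦ (continuous_infinite_coord w).norm.pow _).mul
    (continuous_finsetProd _ fun p _ ↦ (continuous_finite_coord p).norm)

/-- Dropping factors ≤ 1 bounds the norm by a finite product, which is continuous for the adelic
topology. -/
theorem ideleNorm_le_partialNorm {T : Finset (HeightOneSpectrum (𝓞 K))} {a : Idele K}
    (h : ∀ p ∉ T, ‖(a : Adele K).2 p‖ ≤ 1) : ideleNorm a ≤ partialNorm T a := by
  classical
  have hfin := finite_norm_ne_one a
  rw [ideleNorm_apply, partialNorm]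
  refine mul_le_mul_of_nonneg_left ?_ (Finset.prod_nonneg fun _ _ ↦ by positivity)
  rw [finprod_eq_prod_of_mulSupport_subset (s := T ∪ hfin.toFinset) _ (by
    intro p hp
    simpa using Or.inr hp), ← Finset.prod_sdiff (Finset.subset_union_left (s₁ := T))]
  refine mul_le_of_le_one_left (Finset.prod_nonneg fun _ _ ↦ norm_nonneg _)
    (Finset.prod_le_one (fun _ _ ↦ norm_nonneg _) fun p hp ↦ h p (Finset.mem_sdiff.1 hp).2)

theorem partialNorm_insert [DecidableEq (HeightOneSpectrum (𝓞 K))]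
    {T : Finset (HeightOneSpectrum (𝓞 K))} {q : HeightOneSpectrum (𝓞 K)} (hq : q ∉ T)
    (a : Adele K) : partialNorm (insert q T) a = partialNorm T a * ‖a.2 q‖ := by
  rw [partialNorm, partialNorm, Finset.prod_insert hq]
  ring

theorem norm_le_half (p : HeightOneSpectrum (𝓞 K)) {x : p.adicCompletion K} (h : ‖x‖ < 1) :
    ‖x‖ ≤ 1 / 2 := by
  have h2 : (2 : ℝ) ≤ Ideal.absNorm p.asIdeal := by
    exact_mod_cast HeightOneSpectrum.one_lt_absNorm p
  nlinarith [norm_mul_absNorm_le_one p h, norm_nonneg x]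

/-- A non-invertible adele either vanishes somewhere, giving a zero factor, or has infinitely many
non-unit coordinates. All but finitely many of the latter have norm < 1, hence at most 1/2. -/
theorem exists_partialNorm_lt {a : Adele K} (ha : ¬ IsUnit a) {ε : ℝ} (hε : 0 < ε) :
    ∃ T : Finset (HeightOneSpectrum (𝓞 K)), (∀ p ∉ T, ‖a.2 p‖ ≤ 1) ∧ partialNorm T a < ε := by
  classical
  have hbad : {p | ¬ ‖a.2 p‖ ≤ 1}.Finite := eventually_norm_le_one a
  have hT : ∀ T : Finset (HeightOneSpectrum (𝓞 K)), hbad.toFinset ⊆ T → ∀ p ∉ T, ‖a.2 p‖ ≤ 1 := by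
    intro T hT p hp
    by_contra h
    exact hp (hT (hbad.mem_toFinset.2 h))
  rw [isUnit_adele_iff] at ha
  by_cases h1 : ∀ w, a.1 w ≠ 0
  swap
  · push Not at h1
    obtain ⟨w, hw⟩ := h1
    refine ⟨_, hT _ subset_rfl, ?_⟩
    rw [partialNorm, Finset.prod_eq_zero (Finset.mem_univ w), zero_mul]
    · exact hε
    · rw [hw, norm_zero, zero_pow w.mult_ne_zero]
  by_cases h2 : ∀ p, a.2 p ≠ 0
  swap
  · push Not at h2
    obtain ⟨p, hp⟩ := h2
    refine ⟨insert p hbad.toFinset, hT _ (Finset.subset_insert _ _), ?_⟩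
    rw [partialNorm, Finset.prod_eq_zero (Finset.mem_insert_self p _), mul_zero]
    · exact hε
    · rw [hp, norm_zero]
  have h3 : {p | ¬ ‖a.2 p‖ = 1}.Infinite := fun h ↦ ha ⟨h1, h2, h⟩
  have h4 : ∀ n : ℕ, ∃ T : Finset (HeightOneSpectrum (𝓞 K)), hbad.toFinset ⊆ T ∧
      partialNorm T a ≤ partialNorm hbad.toFinset a * (1 / 2) ^ n := by
    intro n
    induction n with
    | zero => exact ⟨_, subset_rfl, by simp⟩
    | succ n ih =>
      obtain ⟨T, hbT, hTn⟩ := ih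
      obtain ⟨q, hq, hqT⟩ := h3.exists_notMem_finset T
      refine ⟨insert q T, hbT.trans (Finset.subset_insert _ _), ?_⟩
      rw [partialNorm_insert hqT, pow_succ, ← mul_assoc]
      exact mul_le_mul hTn (norm_le_half q (lt_of_le_of_ne (hT T hbT q hqT) hq)) (norm_nonneg _)
        (mul_nonneg (partialNorm_nonneg _ _) (by positivity))
  have h5 : Tendsto (fun n : ℕ ↦ partialNorm hbad.toFinset a * (1 / 2 : ℝ) ^ n) atTop (𝓝 0) := by
    simpa using (tendsto_pow_atTop_nhds_zero_of_lt_one (r := (1 / 2 : ℝ)) (by norm_num)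
      (by norm_num)).const_mul (partialNorm hbad.toFinset a)
  obtain ⟨n, hn⟩ := (h5.eventually (gt_mem_nhds hε)).exists
  obtain ⟨T, hbT, hTn⟩ := h4 n
  exact ⟨T, hT T hbT, hTn.trans_lt hn⟩

theorem norm_le_one_of_norm_sub_le_one {p : HeightOneSpectrum (𝓞 K)} {x y : p.adicCompletion K}
    (hx : ‖x‖ ≤ 1) (hxy : ‖y - x‖ ≤ 1) : ‖y‖ ≤ 1 := by
  rw [← sub_add_cancel y x]
  exact (IsUltrametricDist.norm_add_le_max _ _).trans (max_le hxy hx)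

/-- Near a non-invertible adele, ideles have small norm. -/
theorem eventually_ideleNorm_lt {a : Adele K} (ha : ¬ IsUnit a) {ε : ℝ} (hε : 0 < ε) :
    ∀ᶠ b in 𝓝 a, ∀ c : Idele K, (c : Adele K) = b → ideleNorm c < ε := by
  obtain ⟨T, hT, hTε⟩ := exists_partialNorm_lt ha hε
  filter_upwards [setOf_forall_norm_sub_le_mem_nhds a,
    (continuous_partialNorm T).continuousAt.eventually (gt_mem_nhds hTε)]
  rintro _ hb hbT c rfl
  exact (ideleNorm_le_partialNorm fun p hp ↦ norm_le_one_of_norm_sub_le_one (hT p hp) (hb p)).trans_lt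
    hbT

theorem isUnit_of_mem_closure {X : Set (Idele K)} {ε : ℝ} (hε : 0 < ε)
    (hX : ∀ b ∈ X, ε ≤ ideleNorm b) {a : Adele K}
    (ha : a ∈ closure ((fun b : Idele K ↦ (b : Adele K)) '' X)) : IsUnit a := by
  by_contra h
  obtain ⟨_, hlt, b, hb, rfl⟩ := mem_closure_iff_nhds.1 ha _ (eventually_ideleNorm_lt h hε)
  exact (hX b hb).not_gt (hlt b rfl)

/-- On ideles of norm bounded away from zero, inversion is continuous for the adelic topology. -/
theorem tendsto_inv_of_le_ideleNorm {X : Set (Idele K)} {ε : ℝ} (hε : 0 < ε)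
    (hX : ∀ b ∈ X, ε ≤ ideleNorm b) (a : Idele K) :
    Tendsto (fun b : Idele K ↦ ((b⁻¹ : Idele K) : Adele K))
      (comap (fun b : Idele K ↦ (b : Adele K)) (𝓝 (a : Adele K)) ⊓ 𝓟 X)
      (𝓝 ((a⁻¹ : Idele K) : Adele K)) := by
  classical
  set l := comap (fun b : Idele K ↦ (b : Adele K)) (𝓝 (a : Adele K)) ⊓ 𝓟 X with hl
  have hcoe : Tendsto (fun b : Idele K ↦ (b : Adele K)) l (𝓝 (a : Adele K)) :=
    tendsto_comap.mono_left inf_le_left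
  have hXl : ∀ᶠ b in l, b ∈ X := mem_inf_of_right (mem_principal_self X)
  obtain ⟨ha1, ha2, ha3⟩ := (isUnit_adele_iff (a : Adele K)).1 a.isUnit
  have hT : {p | ¬ ‖(a : Adele K).2 p‖ = 1}.Finite := ha3
  set T := hT.toFinset
  have hTa : ∀ p ∉ T, ‖(a : Adele K).2 p‖ = 1 := fun p hp ↦ by
    by_contra h
    exact hp (hT.mem_toFinset.2 h)
  set M := partialNorm T (a : Adele K) + 1 with hM
  have hM0 : 0 < M := by linarith [partialNorm_nonneg T (a : Adele K)]
  -- At a prime outside T with N(q) > M/ε, a non-unit coordinate of b would have norm at most 1/N(q)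
  -- and push the norm of b below ε.
  have hQ : {q : HeightOneSpectrum (𝓞 K) | Ideal.absNorm q.asIdeal ≤ ⌊M / ε⌋₊}.Finite :=
    (Ideal.finite_setOfPred_absNorm_le (S := 𝓞 K) ⌊M / ε⌋₊).preimage
      (fun p _ q _ h ↦ HeightOneSpectrum.ext h)
  set T' := T ∪ hQ.toFinset
  have hb1 : ∀ᶠ b : Idele K in l, ∀ p, ‖(b : Adele K).2 p - (a : Adele K).2 p‖ ≤ 1 :=
    hcoe.eventually (setOf_forall_norm_sub_le_mem_nhds (a : Adele K))
  have hbM : ∀ᶠ b : Idele K in l, partialNorm T (b : Adele K) < M :=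
    hcoe.eventually ((continuous_partialNorm T).continuousAt.eventually
      (gt_mem_nhds (lt_add_one _)))
  have hunit : ∀ᶠ b : Idele K in l, ∀ p ∉ T', ‖(b : Adele K).2 p‖ = 1 := by
    filter_upwards [hb1, hbM, hXl] with b hb1 hbM hbX q hq
    have hqT : q ∉ T := fun h ↦ hq (Finset.mem_union_left _ h)
    have hqQ : ⌊M / ε⌋₊ < Ideal.absNorm q.asIdeal := by
      by_contra h
      exact hq (Finset.mem_union_right _ (hQ.mem_toFinset.2 (not_lt.1 h)))
    have hle : ∀ p ∉ T, ‖(b : Adele K).2 p‖ ≤ 1 := fun p hp ↦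
      norm_le_one_of_norm_sub_le_one (hTa p hp).le (hb1 p)
    refine (hle q hqT).antisymm (not_lt.1 fun hlt ↦ ?_)
    have h1 : ε ≤ partialNorm T (b : Adele K) * ‖(b : Adele K).2 q‖ := by
      rw [← partialNorm_insert hqT]
      exact (hX b hbX).trans (ideleNorm_le_partialNorm fun p hp ↦
        hle p fun h ↦ hp (Finset.mem_insert_of_mem h))
    have h2 := norm_mul_absNorm_le_one q hlt
    have h3 : M / ε < Ideal.absNorm q.asIdeal := (Nat.floor_lt (by positivity)).1 hqQ
    rw [div_lt_iff₀ hε] at h3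
    have h4 : ε ≤ M * ‖(b : Adele K).2 q‖ :=
      h1.trans (mul_le_mul_of_nonneg_right hbM.le (norm_nonneg _))
    have hN := one_lt_absNorm_real q
    nlinarith
  intro U hU
  obtain ⟨S, δ, hδ, hbox⟩ := exists_box_of_mem_nhds hU
  have hinf : ∀ᶠ b in l, ∀ w, ‖((b⁻¹ : Idele K) : Adele K).1 w -
      ((a⁻¹ : Idele K) : Adele K).1 w‖ < δ := by
    rw [eventually_all]
    intro w
    simp only [infinite_coord_inv]
    have := (((continuous_infinite_coord w).tendsto _).comp hcoe).inv₀ (ha1 w)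
    simpa only [← dist_eq_norm, Function.comp_apply] using! this.eventually (Metric.ball_mem_nhds _ hδ)
  have hfin : ∀ᶠ b in l, ∀ p ∈ S ∪ T', ‖((b⁻¹ : Idele K) : Adele K).2 p -
      ((a⁻¹ : Idele K) : Adele K).2 p‖ < min δ 1 := by
    rw [Finset.eventually_all]
    intro p _
    simp only [finite_coord_inv]
    have := (((continuous_finite_coord p).tendsto _).comp hcoe).inv₀ (ha2 p)
    simpa only [← dist_eq_norm, Function.comp_apply] using! this.eventually (Metric.ball_mem_nhds _ (lt_min hδ one_pos))
  rw [mem_map]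
  filter_upwards [hinf, hfin, hunit] with b h1 h2 h3
  refine hbox _ h1 (fun p ↦ ?_) fun p hp ↦
    (h2 p (Finset.mem_union_left _ hp)).trans_le (min_le_left _ _)
  by_cases hp : p ∈ T'
  · exact (h2 p (Finset.mem_union_right _ hp)).le.trans (min_le_right _ _)
  -- Away from T' both coordinates are units, so their inverses differ by an integral element.
  · refine (norm_sub_le_max p _ _).trans (max_le ?_ ?_)
    · rw [finite_coord_inv, norm_inv, h3 p hp, inv_one]
    · rw [finite_coord_inv, norm_inv, hTa p fun h ↦ hp (Finset.mem_union_left _ h), inv_one]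

/-- A set of ideles of norm bounded away from zero has the same closure in the ideles and in the
adeles. -/
theorem closure_image_coe_of_le_ideleNorm {X : Set (Idele K)} {ε : ℝ} (hε : 0 < ε)
    (hX : ∀ b ∈ X, ε ≤ ideleNorm b) :
    closure ((fun b : Idele K ↦ (b : Adele K)) '' X) =
      (fun b : Idele K ↦ (b : Adele K)) '' closure X := by
  refine Set.Subset.antisymm (fun a ha ↦ ?_) (image_closure_subset_closure_image Units.continuous_val)
  obtain ⟨a, rfl⟩ := isUnit_of_mem_closure hε hX ha
  refine ⟨a, ?_, rfl⟩
  have hne : (comap (fun b : Idele K ↦ (b : Adele K)) (𝓝 (a : Adele K)) ⊓ 𝓟 X).NeBot := by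
    rw [inf_principal_neBot_iff]
    rintro V ⟨U, hU, hUV⟩
    obtain ⟨_, hxU, x, hx, rfl⟩ := mem_closure_iff_nhds.1 ha U hU
    exact ⟨x, hUV hxU, hx⟩
  -- The unit topology is induced by b ↦ (b, b⁻¹), so adelic convergence of the inverses is all that
  -- remains.
  have hle : comap (fun b : Idele K ↦ (b : Adele K)) (𝓝 (a : Adele K)) ⊓ 𝓟 X ≤ 𝓝 a := by
    rw [Units.isInducing_embedProduct.nhds_eq_comap, ← map_le_iff_le_comap, Units.embedProduct_apply,
      nhds_prod_eq]
    exact Tendsto.prodMk (tendsto_comap.mono_left inf_le_left)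
      ((MulOpposite.continuous_op.tendsto _).comp (tendsto_inv_of_le_ideleNorm hε hX a))
  exact mem_closure_iff_clusterPt.2 (hne.mono (le_inf hle inf_le_right))

theorem ideleClassNorm_mk (a : Idele K) :
    ideleClassNorm K (QuotientGroup.mk a) = ideleNorm a := rfl

theorem continuous_inr_quasiOrbit : Continuous[_, quasiOrbitTopology K]
    (Sum.inr : IdeleClass K → Set (Place K) ⊕ IdeleClass K) := by
  let _ := quasiOrbitTopology K
  rw [QuotientGroup.isOpenQuotientMap_mk.isQuotientMap.continuous_iff]
  have : (Sum.inr : IdeleClass K → Set (Place K) ⊕ IdeleClass K) ∘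
      (QuotientGroup.mk : Idele K → IdeleClass K) = quasiOrbitMap K ∘ Units.val :=
    funext fun a ↦ (quasiOrbitMap_coe a).symm
  rw [this]
  exact (continuous_quasiOrbitMap (K := K)).comp Units.continuous_val

theorem preimage_quasiOrbitMap_inr (B : Set (IdeleClass K)) :
    quasiOrbitMap K ⁻¹' (Sum.inr '' B) =
      (fun b : Idele K ↦ (b : Adele K)) '' ((QuotientGroup.mk : Idele K → IdeleClass K) ⁻¹' B) := by
  ext a
  by_cases ha : IsUnit a
  · obtain ⟨a, rfl⟩ := ha
    simp only [Set.mem_preimage, quasiOrbitMap_coe, Set.mem_image, Sum.inr.injEq, exists_eq_right]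
    exact ⟨fun h ↦ ⟨a, h, rfl⟩, fun ⟨x, hx, e⟩ ↦ Units.ext e ▸ hx⟩
  · simp only [Set.mem_preimage, quasiOrbitMap_of_not_isUnit ha, Set.mem_image, reduceCtorEq,
      and_false, exists_false, false_iff]
    rintro ⟨b, -, rfl⟩
    exact ha b.isUnit

/-- Norms are nonnegative, so avoiding 0 in the closure means a uniform lower bound. Since the
quotient map is open, taking preimages commutes with closure, and the idelic closure upstairs is
adelically closed. -/
theorem closure_inr_eq {B : Set (IdeleClass K)}
    (hB : (0 : ℝ) ∉ closure (ideleClassNorm K '' B)) :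
    closure[quasiOrbitTopology K] (Sum.inr '' B) = Sum.inr '' closure B := by
  obtain ⟨ε, hε, hεB⟩ : ∃ ε > 0, ∀ b ∈ B, ε ≤ ideleClassNorm K b := by
    rw [Metric.mem_closure_iff] at hB
    push Not at hB
    obtain ⟨ε, hε, h⟩ := hB
    refine ⟨ε, hε, fun b hb ↦ ?_⟩
    have h0 : 0 ≤ ideleClassNorm K b := by
      obtain ⟨a, rfl⟩ := QuotientGroup.mk_surjective b
      exact ideleNorm_nonneg a
    simpa [abs_of_nonneg h0] using h _ ⟨b, hb, rfl⟩
  let _ := quasiOrbitTopology K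
  refine Set.Subset.antisymm (closure_minimal (Set.image_mono subset_closure) ?_)
    (image_closure_subset_closure_image (continuous_inr_quasiOrbit (K := K)))
  rw [isClosed_quasiOrbit_iff, preimage_quasiOrbitMap_inr,
    QuotientGroup.isOpenMap_coe.preimage_closure_eq_closure_preimage QuotientGroup.continuous_mk,
    ← closure_image_coe_of_le_ideleNorm hε (X := QuotientGroup.mk ⁻¹' B) fun b hb ↦ hεB _ hb]
  exact isClosed_closure

/-! ### The adeles as the sum of K and a bounded box. -/

theorem exists_norm_sub_embedding_lt (p : HeightOneSpectrum (𝓞 K)) (x : p.adicCompletion K) {ε : ℝ}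
    (hε : 0 < ε) : ∃ k : K, ‖x - FinitePlace.embedding p k‖ < ε := by
  obtain ⟨k, hk⟩ := Metric.denseRange_iff.1 (HeightOneSpectrum.denseRange_algebraMap K p) x ε hε
  exact ⟨k, by rw [← dist_eq_norm]; exact hk⟩

/-- The divisibility of integers by a fixed `m` at `p` is detected by a power of `p`. -/
theorem exists_forall_mem_pow_norm_le (p : HeightOneSpectrum (𝓞 K)) {m : 𝓞 K} (hm : m ≠ 0) :
    ∃ n : ℕ, ∀ x ∈ p.asIdeal ^ n, ‖FinitePlace.embedding p (algebraMap (𝓞 K) K x)‖ ≤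
      ‖FinitePlace.embedding p (algebraMap (𝓞 K) K m)‖ := by
  obtain ⟨n, hn⟩ : ∃ n : ℕ, p.intValuation m = WithZero.exp (-(n : ℤ)) :=
    ⟨_, p.intValuation_if_neg hm⟩
  refine ⟨n, fun x hx ↦ ?_⟩
  rw [← HeightOneSpectrum.intValuation_le_pow_iff_mem, ← hn] at hx
  rw [FinitePlace.norm_embedding_int, FinitePlace.norm_embedding_int]
  exact_mod_cast (WithZeroMulInt.toNNReal_strictMono
    (HeightOneSpectrum.one_lt_absNorm_nnreal p)).monotone hx

theorem finite_norm_embedding_ne_one {k : K} (hk : k ≠ 0) :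
    {p : HeightOneSpectrum (𝓞 K) | ‖FinitePlace.embedding p k‖ ≠ 1}.Finite :=
  finite_norm_ne_one (Units.map (algebraMap K (Adele K)).toMonoidHom (Units.mk0 k hk))

/-- The finite adeles are the sum of the field and the integral adeles. -/
theorem exists_forall_norm_sub_embedding_le_one (a : Adele K) :
    ∃ k : K, ∀ p, ‖a.2 p - FinitePlace.embedding p k‖ ≤ 1 := by
  classical
  have hbad : {p | ¬ ‖a.2 p‖ ≤ 1}.Finite := eventually_norm_le_one a
  choose k hk using fun p ↦ exists_norm_sub_embedding_lt p (a.2 p) one_pos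
  obtain ⟨⟨m, hm⟩, hmk⟩ := IsLocalization.exist_integer_multiples_of_finset
    (nonZeroDivisors (𝓞 K)) (hbad.toFinset.image k)
  have hm0 : m ≠ 0 := nonZeroDivisors.ne_zero hm
  have hy : ∀ p, ∃ y : 𝓞 K, (p ∈ hbad.toFinset → algebraMap (𝓞 K) K y = algebraMap (𝓞 K) K m * k p) ∧
      (p ∉ hbad.toFinset → y = 0) := by
    intro p
    by_cases hp : p ∈ hbad.toFinset
    · obtain ⟨y, hy⟩ := hmk _ (Finset.mem_image_of_mem k hp)
      exact ⟨y, fun _ ↦ by rw [hy, Algebra.smul_def], fun h ↦ absurd hp h⟩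
    · exact ⟨0, fun h ↦ absurd h hp, fun _ ↦ rfl⟩
  choose y hy hy0 using hy
  have hmK : algebraMap (𝓞 K) K m ≠ 0 := by simpa using hm0
  have hT := finite_norm_embedding_ne_one hmK
  choose e he using fun p ↦ exists_forall_mem_pow_norm_le p hm0
  -- With m a common denominator of the local approximations k p = y p / m, the Chinese remainder
  -- theorem yields z so close to each y p that (z - y p) / m is integral at p. Primes where m is
  -- not a unit are included with y p = 0 when a is integral there.
  obtain ⟨z, hz⟩ := exists_forall_sub_mem_ideal (s := hbad.toFinset ∪ hT.toFinset)
    (fun p : HeightOneSpectrum (𝓞 K) ↦ p.asIdeal) e (fun p _ ↦ p.prime)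
    (fun p _ q _ h h' ↦ h (HeightOneSpectrum.ext h')) (fun p ↦ y p)
  have hzy : ∀ p, ‖FinitePlace.embedding p (algebraMap (𝓞 K) K (z - y p) / algebraMap (𝓞 K) K m)‖
      ≤ 1 := by
    intro p
    rw [map_div₀, norm_div]
    refine div_le_one_of_le₀ ?_ (norm_nonneg _)
    by_cases hp : p ∈ hbad.toFinset ∪ hT.toFinset
    · exact he p _ (hz p hp)
    · have : ‖FinitePlace.embedding p (algebraMap (𝓞 K) K m)‖ = 1 := by
        by_contra h
        exact hp (Finset.mem_union_right _ (hT.mem_toFinset.2 h))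
      rw [this]
      exact FinitePlace.norm_le_one K p _
  refine ⟨algebraMap (𝓞 K) K z / algebraMap (𝓞 K) K m, fun p ↦ ?_⟩
  by_cases hp : p ∈ hbad.toFinset
  · have e1 : a.2 p - FinitePlace.embedding p (algebraMap (𝓞 K) K z / algebraMap (𝓞 K) K m) =
        (a.2 p - FinitePlace.embedding p (k p)) -
        FinitePlace.embedding p (algebraMap (𝓞 K) K (z - y p) / algebraMap (𝓞 K) K m) := by
      rw [map_sub, hy p hp, sub_div, mul_div_cancel_left₀ _ hmK, map_sub]
      ring
    rw [e1]
    exact (norm_sub_le_max p _ _).trans (max_le (hk p).le (hzy p))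
  · have h1 := hzy p
    rw [hy0 p hp, sub_zero] at h1
    refine (norm_sub_le_max p _ _).trans (max_le ?_ h1)
    by_contra h
    exact hp (hbad.mem_toFinset.2 h)

open scoped Classical in
theorem norm_infinite_coord_le (x : InfiniteAdeleRing K) (w : InfinitePlace K) :
    ‖x w‖ ≤ ‖InfiniteAdeleRing.ringEquiv_mixedSpace K x‖ := by
  have h : ‖x w‖ = mixedEmbedding.normAtPlace w (InfiniteAdeleRing.ringEquiv_mixedSpace K x) := by
    rcases w.isReal_or_isComplex with hw | hw
    · rw [mixedEmbedding.normAtPlace_apply_of_isReal hw,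
        InfiniteAdeleRing.ringEquiv_mixedSpace_apply]
      exact ((InfinitePlace.Completion.isometry_extensionEmbeddingOfIsReal hw).norm_map_of_map_zero
        (map_zero _) _).symm
    · rw [mixedEmbedding.normAtPlace_apply_of_isComplex hw,
        InfiniteAdeleRing.ringEquiv_mixedSpace_apply]
      exact ((InfinitePlace.Completion.isometry_extensionEmbedding w).norm_map_of_map_zero
        (map_zero _) _).symm
  rw [h, mixedEmbedding.norm_eq_sup'_normAtPlace]
  exact Finset.le_sup' (fun w ↦ mixedEmbedding.normAtPlace w _) (Finset.mem_univ w)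

variable (K) in
/-- The ring of integers is cocompact in the infinite adeles. -/
theorem exists_forall_exists_norm_sub_le : ∃ R : ℝ, ∀ x : InfiniteAdeleRing K, ∃ z : 𝓞 K,
    ∀ w, ‖x w - algebraMap K w.Completion (algebraMap (𝓞 K) K z)‖ ≤ R := by
  classical
  let b := mixedEmbedding.latticeBasis K
  refine ⟨∑ i, ‖b i‖, fun x ↦ ?_⟩
  have hfl : (ZSpan.floor b (InfiniteAdeleRing.ringEquiv_mixedSpace K x) : mixedEmbedding.mixedSpace K) ∈
      mixedEmbedding.integerLattice K :=
    (mixedEmbedding.mem_span_latticeBasis K).1 (SetLike.coe_mem _)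
  obtain ⟨z, hz⟩ := hfl
  refine ⟨z, fun w ↦ ?_⟩
  -- Subtracting the lattice point leaves an element of the fundamental parallelotope, bounded by
  -- the sum of the basis norms.
  have h1 := ZSpan.norm_fract_le b (InfiniteAdeleRing.ringEquiv_mixedSpace K x)
  rw [ZSpan.fract_apply, ← hz] at h1
  have h2 : mixedEmbedding K (algebraMap (𝓞 K) K z) = InfiniteAdeleRing.ringEquiv_mixedSpace K
      (algebraMap K (InfiniteAdeleRing K) (algebraMap (𝓞 K) K z)) :=
    InfiniteAdeleRing.mixedEmbedding_eq_algebraMap_comp K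
  change ‖_ - mixedEmbedding K (algebraMap (𝓞 K) K z)‖ ≤ _ at h1
  rw [h2, ← map_sub] at h1
  exact (norm_infinite_coord_le (x - algebraMap K (InfiniteAdeleRing K) (algebraMap (𝓞 K) K z))
    w).trans h1

-- Clear the finite coordinates first; the later correction by an algebraic integer at the infinite
-- places preserves integrality.
variable (K) in
theorem exists_forall_exists_box : ∃ R : ℝ, ∀ a : Adele K, ∃ k : K,
    (∀ w, ‖(a - algebraMap K (Adele K) k).1 w‖ ≤ R) ∧
    ∀ p, ‖(a - algebraMap K (Adele K) k).2 p‖ ≤ 1 := by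
  obtain ⟨R, hR⟩ := exists_forall_exists_norm_sub_le K
  refine ⟨R, fun a ↦ ?_⟩
  obtain ⟨k, hk⟩ := exists_forall_norm_sub_embedding_le_one a
  obtain ⟨z, hz⟩ := hR (a - algebraMap K (Adele K) k).1
  refine ⟨k + algebraMap (𝓞 K) K z, fun w ↦ ?_, fun p ↦ ?_⟩
  · rw [map_add, ← sub_sub]
    exact hz w
  · rw [map_add, ← sub_sub]
    exact (norm_sub_le_max p _ _).trans (max_le (hk p) (FinitePlace.norm_le_one K p z))

/-! ### Minkowski's theorem for ideles. -/

theorem norm_embedding_le_of_mem_pow (p : HeightOneSpectrum (𝓞 K)) {n : ℕ} {x : 𝓞 K}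
    (hx : x ∈ p.asIdeal ^ n) : ‖FinitePlace.embedding p (algebraMap (𝓞 K) K x)‖ ≤
      ((Ideal.absNorm p.asIdeal : ℝ) ^ n)⁻¹ := by
  rw [← HeightOneSpectrum.intValuation_le_pow_iff_mem] at hx
  have h := (WithZeroMulInt.toNNReal_strictMono
    (HeightOneSpectrum.one_lt_absNorm_nnreal p)).monotone hx
  have h2 : WithZeroMulInt.toNNReal (HeightOneSpectrum.one_lt_absNorm_nnreal p).ne_zero
      (WithZero.exp (-(n : ℤ))) = ((Ideal.absNorm p.asIdeal : NNReal) ^ n)⁻¹ := by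
    rw [WithZeroMulInt.toNNReal_neg_apply _ WithZero.exp_ne_zero, ← zpow_natCast, ← zpow_neg]
    rfl
  rw [h2] at h
  rw [FinitePlace.norm_embedding_int]
  exact_mod_cast h

theorem mem_pow_of_mem_prod {R : Type*} [CommRing R] [IsDedekindDomain R]
    {T : Finset (HeightOneSpectrum R)} {n : HeightOneSpectrum R → ℕ} {x : R}
    (hx : x ∈ ∏ p ∈ T, p.asIdeal ^ n p) {p : HeightOneSpectrum R} (hp : p ∈ T) :
    x ∈ p.asIdeal ^ n p :=
  Ideal.le_of_dvd (Finset.dvd_prod_of_mem _ hp) hx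

theorem prod_pow_ne_bot {R : Type*} [CommRing R] [IsDedekindDomain R]
    (T : Finset (HeightOneSpectrum R)) (n : HeightOneSpectrum R → ℕ) :
    ∏ p ∈ T, p.asIdeal ^ n p ≠ ⊥ :=
  Finset.prod_ne_zero_iff.2 fun p _ ↦ pow_ne_zero _ p.ne_bot

theorem exists_integer_norm_le (T : Finset (HeightOneSpectrum (𝓞 K)))
    (n : HeightOneSpectrum (𝓞 K) → ℕ) : ∃ m : 𝓞 K, m ≠ 0 ∧
      ∀ p ∈ T, ‖FinitePlace.embedding p (algebraMap (𝓞 K) K m)‖ ≤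
        ((Ideal.absNorm p.asIdeal : ℝ) ^ n p)⁻¹ := by
  obtain ⟨m, hm, hm0⟩ := Submodule.exists_mem_ne_zero_of_ne_bot (prod_pow_ne_bot T n)
  exact ⟨m, hm0, fun p hp ↦ norm_embedding_le_of_mem_pow p (mem_pow_of_mem_prod hm hp)⟩

/-- The principal idele of a nonzero element. -/
noncomputable def principal (k : Kˣ) : Idele K :=
  Units.map (algebraMap K (Adele K)).toMonoidHom k

theorem ideleNorm_principal (k : Kˣ) : ideleNorm (principal k) = 1 :=
  principalIdeles_le_ker ⟨k, rfl⟩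

theorem norm_principal_finite (k : Kˣ) (p : HeightOneSpectrum (𝓞 K)) :
    ‖(principal k : Adele K).2 p‖ = ‖FinitePlace.embedding p (k : K)‖ := rfl

theorem norm_principal_infinite (k : Kˣ) (w : InfinitePlace K) :
    ‖(principal k : Adele K).1 w‖ = w (k : K) :=
  InfinitePlace.Completion.norm_coe w _

theorem norm_mul_infinite (a b : Adele K) (w : InfinitePlace K) :
    ‖(a * b).1 w‖ = ‖a.1 w‖ * ‖b.1 w‖ := norm_mul _ _

theorem norm_mul_finite (a b : Adele K) (p : HeightOneSpectrum (𝓞 K)) :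
    ‖(a * b).2 p‖ = ‖a.2 p‖ * ‖b.2 p‖ := norm_mul _ _

theorem infinite_coord_ne_zero (a : Idele K) (w : InfinitePlace K) : (a : Adele K).1 w ≠ 0 :=
  ((isUnit_adele_iff _).1 a.isUnit).1 w

theorem finite_coord_ne_zero (a : Idele K) (p : HeightOneSpectrum (𝓞 K)) : (a : Adele K).2 p ≠ 0 :=
  ((isUnit_adele_iff _).1 a.isUnit).2.1 p

variable (K) in
open MeasureTheory in
/-- Minkowski's theorem for an ideal, with a constant independent of the ideal. -/
theorem exists_minkowski_ideal : ∃ C : ℝ, 0 < C ∧ ∀ I : Ideal (𝓞 K), I ≠ ⊥ →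
    ∀ f : InfinitePlace K → ℝ, (∀ w, 0 < f w) →
    (Ideal.absNorm I : ℝ) < C * ∏ w, f w ^ w.mult →
    ∃ x ∈ I, x ≠ 0 ∧ ∀ w : InfinitePlace K, w (algebraMap (𝓞 K) K x) < f w := by
  classical
  set V := volume (ZSpan.fundamentalDomain (mixedEmbedding.latticeBasis K)) *
    2 ^ Module.finrank ℝ (mixedEmbedding.mixedSpace K) with hV
  have hVtop : V ≠ ⊤ := ENNReal.mul_ne_top
    (ZSpan.fundamentalDomain_isBounded _).measure_lt_top.ne (by simp)
  have hV0 : V ≠ 0 := mul_ne_zero (ZSpan.measure_fundamentalDomain_ne_zero _) (by simp)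
  have hVpos : 0 < V.toReal := ENNReal.toReal_pos hV0 hVtop
  have hc : (0 : ℝ) < mixedEmbedding.convexBodyLTFactor K := by
    exact_mod_cast (mixedEmbedding.convexBodyLTFactor_ne_zero K).bot_lt
  refine ⟨mixedEmbedding.convexBodyLTFactor K / V.toReal, by positivity,
    fun I hI f hf hlt ↦ ?_⟩
  let J : (FractionalIdeal (nonZeroDivisors (𝓞 K)) K)ˣ :=
    Units.mk0 (I : FractionalIdeal (nonZeroDivisors (𝓞 K)) K)
      (FractionalIdeal.coeIdeal_ne_zero.2 hI)
  -- The covolume of I is N(I) times that of the ring of integers, which is why C does not depend on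
  -- I.
  have hbound : mixedEmbedding.minkowskiBound K J <
      volume (mixedEmbedding.convexBodyLT K fun w ↦ (f w).toNNReal) := by
    rw [mixedEmbedding.minkowskiBound,
      mixedEmbedding.volume_fundamentalDomain_fractionalIdealLatticeBasis,
      mixedEmbedding.convexBodyLT_volume, mul_assoc, ← hV, Units.val_mk0,
      FractionalIdeal.coeIdeal_absNorm, ← ENNReal.ofReal_toReal hVtop,
      ← ENNReal.ofReal_mul (by positivity)]
    have h1 : ((mixedEmbedding.convexBodyLTFactor K : NNReal) : ENNReal) *
        ((∏ w, (f w).toNNReal ^ w.mult : NNReal) : ENNReal) =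
        ENNReal.ofReal (mixedEmbedding.convexBodyLTFactor K * ∏ w, f w ^ w.mult) := by
      rw [ENNReal.ofReal_mul (by positivity), ENNReal.ofReal_coe_nnreal,
        ENNReal.ofReal_prod_of_nonneg fun w _ ↦ pow_nonneg (hf w).le _]
      congr 1
      push_cast
      exact Finset.prod_congr rfl fun w _ ↦ (ENNReal.ofReal_pow (hf w).le _).symm
    rw [h1, ENNReal.ofReal_lt_ofReal_iff]
    · rw [div_mul_eq_mul_div, lt_div_iff₀ hVpos] at hlt
      exact_mod_cast hlt
    · exact mul_pos hc (Finset.prod_pos fun w _ ↦ pow_pos (hf w) _)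
  obtain ⟨a, haJ, ha0, ha⟩ := mixedEmbedding.exists_ne_zero_mem_ideal_lt K J hbound
  obtain ⟨x, hxI, rfl⟩ := (FractionalIdeal.mem_coeIdeal _).1 haJ
  exact ⟨x, hxI, by simpa using ha0, fun w ↦ (ha w).trans_eq (Real.coe_toNNReal _ (hf w).le)⟩

variable (K) in
theorem exists_minkowski_idele_of_one_le : ∃ C : ℝ, 0 < C ∧ ∀ b : Idele K,
    (∀ p, 1 ≤ ‖(b : Adele K).2 p‖) → ∀ f : InfinitePlace K → ℝ, (∀ w, 0 < f w) →
    ideleNorm b < C * ∏ w, f w ^ w.mult →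
    ∃ k : Kˣ, (∀ w, ‖((b * principal k : Idele K) : Adele K).1 w‖ ≤ f w) ∧
      ∀ p, ‖((b * principal k : Idele K) : Adele K).2 p‖ ≤ 1 := by
  obtain ⟨C, hC, h⟩ := exists_minkowski_ideal K
  refine ⟨C, hC, fun b hb f hf hlt ↦ ?_⟩
  have hn : ∀ p, ∃ n : ℕ, ‖(b : Adele K).2 p‖ = (Ideal.absNorm p.asIdeal : ℝ) ^ n := by
    intro p
    obtain ⟨n, hn⟩ := exists_norm_eq_zpow p (finite_coord_ne_zero b p)
    have h0 : 0 ≤ n := (one_le_zpow_iff_right₀ (one_lt_absNorm_real p)).1 (hn ▸ hb p)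
    lift n to ℕ using h0
    exact ⟨n, by rw [hn, zpow_natCast]⟩
  choose n hn using hn
  have hfin := finite_norm_ne_one b
  have hpos : ∀ w, 0 < ‖(b : Adele K).1 w‖ := fun w ↦ norm_pos_iff.2 (infinite_coord_ne_zero b w)
  -- Membership of x in this ideal gives |x|_p ≤ |b_p|⁻¹ at its primes, and its norm is the finite
  -- part of the norm of b; dividing f by |b_w| moves the infinite part to the other side.
  obtain ⟨x, hxI, hx0, hx⟩ := h (∏ p ∈ hfin.toFinset, p.asIdeal ^ n p) (prod_pow_ne_bot _ _)
    (fun w ↦ f w / ‖(b : Adele K).1 w‖) (fun w ↦ div_pos (hf w) (hpos w)) (by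
      rw [ideleNorm_apply, finprod_eq_prod_of_mulSupport_subset (s := hfin.toFinset) _
        (by simp)] at hlt
      have e : ((Ideal.absNorm (∏ p ∈ hfin.toFinset, p.asIdeal ^ n p) : ℕ) : ℝ) =
          ∏ p ∈ hfin.toFinset, ‖(b : Adele K).2 p‖ := by
        rw [map_prod]
        push_cast
        exact Finset.prod_congr rfl fun p _ ↦ by rw [hn p, map_pow, Nat.cast_pow]
      simp only [div_pow, Finset.prod_div_distrib]
      rw [e, ← mul_div_assoc, lt_div_iff₀ (Finset.prod_pos fun w _ ↦ pow_pos (hpos w) _), mul_comm]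
      exact hlt)
  have hxK : algebraMap (𝓞 K) K x ≠ 0 := by simpa using hx0
  refine ⟨Units.mk0 _ hxK, fun w ↦ ?_, fun p ↦ ?_⟩
  · rw [Units.val_mul, norm_mul_infinite, norm_principal_infinite, mul_comm]
    exact ((lt_div_iff₀ (hpos w)).1 (hx w)).le
  · rw [Units.val_mul, norm_mul_finite, norm_principal_finite]
    by_cases hp : p ∈ hfin.toFinset
    · have := norm_embedding_le_of_mem_pow p (mem_pow_of_mem_prod hxI hp)
      rw [← hn p] at this
      exact (mul_le_mul_of_nonneg_left this (norm_nonneg _)).trans_eq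
        (mul_inv_cancel₀ (norm_ne_zero_iff.2 (finite_coord_ne_zero b p)))
    · have : ‖(b : Adele K).2 p‖ = 1 := by
        by_contra h
        exact hp (hfin.mem_toFinset.2 h)
      rw [this, one_mul]
      exact FinitePlace.norm_le_one K p x

variable (K) in
/-- Minkowski's theorem for ideles. -/
theorem exists_minkowski_idele : ∃ C : ℝ, 0 < C ∧ ∀ b : Idele K,
    ∀ f : InfinitePlace K → ℝ, (∀ w, 0 < f w) → ideleNorm b < C * ∏ w, f w ^ w.mult →
    ∃ k : Kˣ, (∀ w, ‖((b * principal k : Idele K) : Adele K).1 w‖ ≤ f w) ∧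
      ∀ p, ‖((b * principal k : Idele K) : Adele K).2 p‖ ≤ 1 := by
  obtain ⟨C, hC, h⟩ := exists_minkowski_idele_of_one_le K
  refine ⟨C, hC, fun b f hf hlt ↦ ?_⟩
  have hfin := finite_norm_ne_one b
  have hn : ∀ p, ∃ n : ℕ, ((Ideal.absNorm p.asIdeal : ℝ) ^ n)⁻¹ ≤ ‖(b : Adele K).2 p‖ := by
    intro p
    have h0 : 0 < ‖(b : Adele K).2 p‖ := norm_pos_iff.2 (finite_coord_ne_zero b p)
    obtain ⟨n, hn⟩ := pow_unbounded_of_one_lt (‖(b : Adele K).2 p‖)⁻¹ (one_lt_absNorm_real p)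
    exact ⟨n, inv_le_of_inv_le₀ h0 hn.le⟩
  choose n hn using hn
  obtain ⟨m, hm0, hm⟩ := exists_integer_norm_le hfin.toFinset n
  have hmK : algebraMap (𝓞 K) K m ≠ 0 := by simpa using hm0
  have hmb : ∀ p, ‖FinitePlace.embedding p (algebraMap (𝓞 K) K m)‖ ≤ ‖(b : Adele K).2 p‖ := by
    intro p
    by_cases hp : p ∈ hfin.toFinset
    · exact (hm p hp).trans (hn p)
    · have : ‖(b : Adele K).2 p‖ = 1 := by
        by_contra h
        exact hp (hfin.mem_toFinset.2 h)
      rw [this]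
      exact FinitePlace.norm_le_one K p m
  -- Dividing by m makes every finite coordinate have norm at least 1, while the product formula
  -- keeps the idelic norm.
  obtain ⟨k, hk⟩ := h (b * principal (Units.mk0 _ hmK)⁻¹) (fun p ↦ by
    rw [Units.val_mul, norm_mul_finite, norm_principal_finite, Units.val_inv_eq_inv_val,
      Units.val_mk0, map_inv₀, norm_inv, ← div_eq_mul_inv, one_le_div]
    · exact hmb p
    · simpa using hm0) f hf (by rwa [map_mul, ideleNorm_principal, mul_one])
  refine ⟨(Units.mk0 _ hmK)⁻¹ * k, ?_⟩
  have e : principal ((Units.mk0 _ hmK)⁻¹ * k) = principal (Units.mk0 _ hmK)⁻¹ * principal k :=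
    map_mul _ _ _
  rwa [e, ← mul_assoc]

/-- An idele of small norm can be moved into a small box by a principal idele. -/
theorem exists_principal_mul_mem_box (S : Finset (HeightOneSpectrum (𝓞 K))) {ε δ : ℝ} (hε : 0 < ε)
    (hδ : 0 < δ) : ∃ c : ℝ, 0 < c ∧ ∀ b : Idele K, ideleNorm b < c → ∃ k : Kˣ,
      (∀ w, ‖((b * principal k : Idele K) : Adele K).1 w‖ ≤ δ) ∧
      (∀ p, ‖((b * principal k : Idele K) : Adele K).2 p‖ ≤ 1) ∧
      ∀ p ∈ S, ‖((b * principal k : Idele K) : Adele K).2 p‖ < ε := by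
  obtain ⟨C, hC, h⟩ := exists_minkowski_idele K
  have hn : ∀ p : HeightOneSpectrum (𝓞 K), ∃ n : ℕ, ((Ideal.absNorm p.asIdeal : ℝ) ^ n)⁻¹ < ε := by
    intro p
    obtain ⟨n, hn⟩ := pow_unbounded_of_one_lt ε⁻¹ (one_lt_absNorm_real p)
    exact ⟨n, inv_lt_of_inv_lt₀ hε hn⟩
  choose n hn using hn
  obtain ⟨m, hm0, hm⟩ := exists_integer_norm_le S n
  have hmK : algebraMap (𝓞 K) K m ≠ 0 := by simpa using hm0
  -- The result is finally multiplied by m to make it small at S; dividing δ by w(m) compensates in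
  -- advance at the infinite places.
  have hf : ∀ w : InfinitePlace K, 0 < δ / w (algebraMap (𝓞 K) K m) := fun w ↦
    div_pos hδ (InfinitePlace.pos_iff.2 hmK)
  refine ⟨C * ∏ w : InfinitePlace K, (δ / w (algebraMap (𝓞 K) K m)) ^ w.mult,
    mul_pos hC (Finset.prod_pos fun w _ ↦ pow_pos (hf w) _), fun b hb ↦ ?_⟩
  obtain ⟨k, hk1, hk2⟩ := h b _ hf hb
  have e : principal (k * Units.mk0 _ hmK) = principal k * principal (Units.mk0 _ hmK) :=
    map_mul _ _ _
  refine ⟨k * Units.mk0 _ hmK, fun w ↦ ?_, fun p ↦ ?_, fun p hp ↦ ?_⟩ <;>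
    rw [e, ← mul_assoc, Units.val_mul]
  · rw [norm_mul_infinite, norm_principal_infinite]
    exact (le_div_iff₀ (InfinitePlace.pos_iff.2 hmK)).1 (hk1 w)
  · rw [norm_mul_finite, norm_principal_finite]
    exact mul_le_one₀ (hk2 p) (norm_nonneg _) (FinitePlace.norm_le_one K p m)
  · rw [norm_mul_finite, norm_principal_finite]
    exact (mul_le_of_le_one_left (norm_nonneg _) (hk2 p)).trans_lt ((hm p hp).trans_lt (hn p))

/-! ### Density when the norms accumulate at zero. -/

theorem mk_mul_principal (b : Idele K) (k : Kˣ) :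
    (QuotientGroup.mk (b * principal k) : IdeleClass K) = QuotientGroup.mk b :=
  QuotientGroup.mk_mul_of_mem b ⟨k, rfl⟩

/-- If the norms of a set of idele classes accumulate at zero, the set is dense in the adeles. -/
theorem dense_coe_preimage_mk {B : Set (IdeleClass K)}
    (hB : (0 : ℝ) ∈ closure (ideleClassNorm K '' B)) :
    Dense ((fun b : Idele K ↦ (b : Adele K)) ''
      ((QuotientGroup.mk : Idele K → IdeleClass K) ⁻¹' B)) := by
  intro a
  rw [mem_closure_iff_nhds]
  intro U hU
  obtain ⟨S, ε, hε, hbox⟩ := exists_box_of_mem_nhds hU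
  obtain ⟨R, hR⟩ := exists_forall_exists_box K
  -- Chosen so that δ(1 + R) ≤ ε/2: the product br contributes δR, and b itself δ when y = 0.
  set δ := ε / (2 * (|R| + 1)) with hδ
  have hδ0 : 0 < δ := by positivity
  have hδR : δ + δ * R < ε := by
    have h1 : δ * (2 * (|R| + 1)) = ε := div_mul_cancel₀ _ (by positivity)
    nlinarith [le_abs_self R, abs_nonneg R]
  obtain ⟨c, hc, hcS⟩ := exists_principal_mul_mem_box S hε hδ0
  obtain ⟨_, ⟨x, hxB, rfl⟩, hx⟩ := Metric.mem_closure_iff.1 hB c hc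
  obtain ⟨b₀, rfl⟩ := QuotientGroup.mk_surjective x
  rw [ideleClassNorm_mk, dist_zero_left, Real.norm_of_nonneg (ideleNorm_nonneg _)] at hx
  obtain ⟨k, hk1, hk2, hk3⟩ := hcS b₀ hx
  rw [← mk_mul_principal b₀ k] at hxB
  set b := b₀ * principal k
  obtain ⟨y, hy1, hy2⟩ := hR (((b⁻¹ : Idele K) : Adele K) * a)
  set r := ((b⁻¹ : Idele K) : Adele K) * a - algebraMap K (Adele K) y with hr
  have hbr : (b : Adele K) * r = a - (b : Adele K) * algebraMap K (Adele K) y := by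
    rw [hr, mul_sub, Units.mul_inv_cancel_left]
  have h1 : ∀ w, ‖((b : Adele K) * r).1 w‖ ≤ δ * R := fun w ↦ by
    rw [norm_mul_infinite]
    exact mul_le_mul (hk1 w) (hy1 w) (norm_nonneg _) hδ0.le
  have h2 : ∀ p, ‖((b : Adele K) * r).2 p‖ ≤ 1 := fun p ↦ by
    rw [norm_mul_finite]
    exact mul_le_one₀ (hk2 p) (norm_nonneg _) (hy2 p)
  have h3 : ∀ p ∈ S, ‖((b : Adele K) * r).2 p‖ < ε := fun p hp ↦ by
    rw [norm_mul_finite]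
    exact (mul_le_of_le_one_right (norm_nonneg _) (hy2 p)).trans_lt (hk3 p hp)
  -- If y = 0 then by is no idele, but a = br lies in the small box, and so does b, which therefore
  -- approximates a.
  rcases eq_or_ne y 0 with rfl | hy0
  · rw [map_zero, mul_zero, sub_zero] at hbr
    rw [hbr] at h1 h2 h3
    exact ⟨b, hbox _ (fun w ↦ (norm_sub_le _ _).trans_lt
      ((add_le_add (hk1 w) (h1 w)).trans_lt hδR))
      (fun p ↦ (norm_sub_le_max p _ _).trans (max_le (hk2 p) (h2 p)))
      (fun p hp ↦ (norm_sub_le_max p _ _).trans_lt (max_lt (hk3 p hp) (h3 p hp))), b, hxB, rfl⟩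
  · rw [hbr] at h1 h2 h3
    refine ⟨_, hbox ((b * principal (Units.mk0 y hy0) : Idele K) : Adele K) (fun w ↦ ?_)
      (fun p ↦ ?_) (fun p hp ↦ ?_), b * principal (Units.mk0 y hy0), ?_, rfl⟩
    · rw [norm_sub_rev]
      exact (h1 w).trans_lt (by linarith)
    · rw [norm_sub_rev]
      exact h2 p
    · rw [norm_sub_rev]
      exact h3 p hp
    · rwa [Set.mem_preimage, mk_mul_principal]

theorem closure_inr_eq_univ {B : Set (IdeleClass K)}
    (hB : (0 : ℝ) ∈ closure (ideleClassNorm K '' B)) :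
    closure[quasiOrbitTopology K] (Sum.inr '' B) = Set.univ := by
  refine Set.eq_univ_of_forall fun x ↦ ?_
  obtain ⟨a, rfl⟩ := quasiOrbitMap_surjective x
  refine quasiOrbitMap_mem_closure ?_
  rw [preimage_quasiOrbitMap_inr]
  exact dense_coe_preimage_mk hB a

end AdelicQuasiOrbit

theorem mainTheorem5 (K : Type*) [Field K] [NumberField K] :
    (∀ B : Set (IdeleClass K),
      ((0 : ℝ) ∉ closure (ideleClassNorm K '' B) →
        closure[quasiOrbitTopology K] (Sum.inr '' B) = Sum.inr '' closure B) ∧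
      ((0 : ℝ) ∈ closure (ideleClassNorm K '' B) →
        closure[quasiOrbitTopology K] (Sum.inr '' B) = Set.univ)) ∧
    (∀ A : Set (Set (Place K)),
      (closure[powerCofinite (Place K)] A ≠ Set.univ →
        closure[quasiOrbitTopology K] (Sum.inl '' A) =
          Sum.inl '' closure[powerCofinite (Place K)] A) ∧
      (closure[powerCofinite (Place K)] A = Set.univ →
        closure[quasiOrbitTopology K] (Sum.inl '' A) = Set.univ)) ∧
    TopologicalSpace.induced Sum.inl (quasiOrbitTopology K) =
      powerCofinite (Place K) := 
  ⟨fun _ ↦ ⟨closure_inr_eq, closure_inr_eq_univ⟩,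
    fun _ ↦ ⟨closure_inl_eq, closure_inl_eq_univ⟩, induced_inl_quasiOrbitTopology⟩
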